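/- Conventions. A metric space is proper if all its closed balls are compact; $B_r(x)$ denotes the open ball. Let $X$ be a proper metric space with a base point $x_0$ (nothing below depends on its choice). Subsets $A,B\subseteq X$ are asymptotically disjoint if $\lim_{r\to\infty} d(A\setminus B_r(x_0),B\setminus B_r(x_0))=\infty$, where $d(S,T)=\inf_{s\in S,t\in T}d(s,t)$ and $d(S,T)=\infty$ if $S$ or $T$ is empty. A function $\varphi:X\to[0,1]$ is slowly oscillating if for all $r,\varepsilon>0$ there is $D>0$ with $\operatorname{diam}\varphi(B_r(x))<\varepsilon$ whenever $d(x,x_0)\ge D$. If $C_h(X)$ is the set of continuous slowly oscillating functions $X\to[0,1]$, the Higson compactification $cX$ is the closure of the image of $X$ in $[0,1]^{C_h(X)}$ under $x\mapsto(\varphi(x))_{\varphi\in C_h(X)}$, and the Higson corona is $\nu X=cX\setminus X$. For $C\subseteq X$ put $C'=\operatorname{cl}_{cX}C\cap\nu X$. A closed set $C\subseteq X$ is an asymptotic separator between asymptotically disjoint sets $A$ and $B$ if $\nu X\setminus C'$ is the union of two disjoint open subsets of $\nu X$, one containing $A'$ and the other containing $B'$. The asymptotic large inductive dimension is defined inductively: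 $\operatorname{asInd}X\le -1$ iff $X$ is bounded; for $n\ge 0$, $\operatorname{asInd}X\le n$ iff any two asymptotically disjoint subsets $A,B\subseteq X$ have an asymptotic separator $C$ with $\operatorname{asInd}C\le n-1$, where $C$ carries the induced metric. An unbounded subset $X_0\subseteq X$ is called a kernel of $X$ if there is a sequence $(k_i)_{i\ge 0}$ of natural numbers with $k_i\to\infty$ such that $B_{k_i}(x)=\{x\}$ for every $i\ge 0$ and every $x\in X$ with $d(x,X_0)>i$. Theorem 1. Let $X$ be a proper metric space, let the closed set $X_0\subseteq X$ be a kernel of $X$, and let $k\ge 0$ be an integer. If $\operatorname{asInd}X_0\le k$ (for the induced metric on $X_0$), then $\operatorname{asInd}X\le k$. -/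

import Mathlib

open Set Filter Topology

universe u

/-- `C` is a partition between `A` and `B` in the topological space `T`: the complement of `C` is
the union of two disjoint open sets, one containing `A`, the other containing `B`. -/
def IsPartitionBetween {T : Type u} [TopologicalSpace T] (A B C : Set T) : Prop :=
  ∃ U V : Set T, IsOpen U ∧ IsOpen V ∧ Disjoint U V ∧ Cᶜ = U ∪ V ∧ A ⊆ U ∧ B ⊆ V

/-- The distance `d(S, T)`, the infimum of all `d(s, t)`; it is `∞` if `S` or `T` is empty. -/
noncomputable def setEDist {X : Type u} [MetricSpace X] (S T : Set X) : ENNReal :=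
  ⨅ s ∈ S, ⨅ t ∈ T, edist s t

/-- `A` and `B` are asymptotically disjoint: `d(A \ B_r(x₀), B \ B_r(x₀)) → ∞` as `r → ∞`. This
does not depend on the base point `x₀`, so we ask it for all of them. -/
def AsympDisjoint {X : Type u} [MetricSpace X] (A B : Set X) : Prop :=
  ∀ x₀ : X, Tendsto (fun r : ℝ => setEDist (A \ Metric.ball x₀ r) (B \ Metric.ball x₀ r))
    atTop (𝓝 ⊤)

/-- `φ : X → [0, 1]` is slowly oscillating: for all `r, ε > 0` the diameter of `φ(B_r(x))` is less
than `ε` as soon as `x` is far enough from the base point (any base point, equivalently). -/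
def SlowlyOscillating {X : Type u} [MetricSpace X] (φ : X → unitInterval) : Prop :=
  ∀ x₀ : X, ∀ r : ℝ, 0 < r → ∀ ε : ℝ, 0 < ε → ∃ D : ℝ, 0 < D ∧
    ∀ x : X, D ≤ dist x x₀ → Metric.diam (φ '' Metric.ball x r) < ε

/-- The set `C_h(X)` of continuous slowly oscillating functions `X → [0, 1]`. -/
def HigsonFun (X : Type u) [MetricSpace X] : Type u :=
  {φ : X → unitInterval // Continuous φ ∧ SlowlyOscillating φ}

/-- The canonical map `X → [0, 1] ^ C_h(X)`, which is an embedding if `X` is proper. -/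
def higsonMap (X : Type u) [MetricSpace X] : X → (HigsonFun X → unitInterval) :=
  fun x φ => φ.1 x

/-- The Higson compactification `cX`, the closure of the image of `X` in `[0, 1] ^ C_h(X)`. -/
def higsonCompactification (X : Type u) [MetricSpace X] : Set (HigsonFun X → unitInterval) :=
  closure (range (higsonMap X))

/-- The Higson corona `νX = cX \ X`; its coercion to a type has the subspace topology. -/
def higsonCorona (X : Type u) [MetricSpace X] : Set (HigsonFun X → unitInterval) :=
  higsonCompactification X \ range (higsonMap X)

/-- The trace `C' = cl C ∩ νX` of `C ⊆ X` in the corona, as a subset of the space `νX`. -/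
def coronaTrace {X : Type u} [MetricSpace X] (C : Set X) : Set (higsonCorona X) :=
  {p | (p : HigsonFun X → unitInterval) ∈ closure (higsonMap X '' C)}

/-- The closed set `C` is an asymptotic separator for (the asymptotically disjoint sets) `A` and
`B`: its trace is a partition between the traces of `A` and `B` in the corona. -/
def IsAsympSeparator {X : Type u} [MetricSpace X] (A B C : Set X) : Prop :=
  IsClosed C ∧ IsPartitionBetween (coronaTrace A) (coronaTrace B) (coronaTrace C)

/-- `AsIndLT n X` says `asInd X < n`, that is `asInd X ≤ n - 1`, for a proper metric space `X`:
`asInd X ≤ -1` means that `X` is bounded, and `asInd X ≤ n` means that any two asymptotically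
disjoint subsets have an asymptotic separator `C` (with the induced metric) such that
`asInd C ≤ n - 1`. -/
def AsIndLT : ℕ → ∀ (X : Type u) [MetricSpace X], Prop
  | 0, X, _ => Bornology.IsBounded (univ : Set X)
  | n + 1, X, _ => ∀ A B : Set X, AsympDisjoint A B →
      ∃ C : Set X, IsAsympSeparator A B C ∧ AsIndLT n C

/-- `asInd X ≤ n` for a natural number `n`. -/
def AsIndLE (X : Type u) [MetricSpace X] (n : ℕ) : Prop :=
  AsIndLT (n + 1) X

/-- The unbounded set `X₀` is a kernel of `X`: there are natural numbers `k i → ∞` such that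
`B_{k i}(x) = {x}` for all `i` and all `x` at distance greater than `i` from `X₀`. -/
def IsKernel {X : Type u} [MetricSpace X] (X₀ : Set X) : Prop :=
  ¬ Bornology.IsBounded X₀ ∧ ∃ k : ℕ → ℕ, Tendsto k atTop atTop ∧
    ∀ i : ℕ, ∀ x : X, x ∉ Metric.cthickening (i : ℝ) X₀ → Metric.ball x (k i : ℝ) = {x}

open Bornology Metric

/-! Let `p` send each point of `X` to a nearest point of the kernel. No induction on `k` is needed:
a suitable separator `C` found inside the kernel is itself a separator of `A` and `B` in `X`.

In the kernel, `C` is chosen to separate the points much closer to `A` than to `B` from those much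
closer to `B` than to `A`. A point `x` whose distance to the kernel is at most the distance from `p
x` to `C` (with a base point added) follows `p x`, unless it lies in `A` or `B` and `p x` is on no
corresponding side. The remaining points form a set `G`. Inside any set asymptotically disjoint from
`C`, the points of `G` drift away from the kernel, hence become arbitrarily isolated, so they can be
put on either side (`AsympSeparation.extend`).

The corona is removed from this argument by a dictionary: in a proper space, sets are asymptotically
disjoint iff their traces are disjoint. Being a separator thus becomes a statement `AsympSeparation`
about families of subsets, phrased through asymptotic disjointness alone. It can be extended from
the kernel to `X`, and it is invariant under isometries. -/

/-! ### Asymptotic disjointness in terms of bounded sets -/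

theorem asympDisjoint_iff {X : Type u} [MetricSpace X] {A B : Set X} :
    AsympDisjoint A B ↔ ∀ R : ℝ, IsBounded {x ∈ A | ∃ y ∈ B, dist x y ≤ R} := by
  constructor
  · intro h R
    rcases eq_empty_or_nonempty {x ∈ A | ∃ y ∈ B, dist x y ≤ R} with he | ⟨x₀, -⟩
    · rw [he]; exact isBounded_empty
    obtain ⟨r, hr⟩ := eventually_atTop.1
      ((h x₀).eventually (lt_mem_nhds (ENNReal.ofReal_lt_top (r := R))))
    refine isBounded_ball.subset (t := ball x₀ (r + R)) ?_
    rintro x ⟨hx, y, hy, hxy⟩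
    by_contra hxr
    rw [mem_ball, not_lt] at hxr
    have hyr : r ≤ dist y x₀ := by linarith [dist_triangle x y x₀]
    have hR : 0 ≤ R := dist_nonneg.trans hxy
    refine (hr r le_rfl).not_ge ((iInf₂_le x ⟨hx, ?_⟩).trans ((iInf₂_le y ⟨hy, ?_⟩).trans ?_))
    · rw [edist_dist]; exact ENNReal.ofReal_le_ofReal hxy
    · rw [mem_ball, not_lt]; linarith
    · rwa [mem_ball, not_lt]
  · intro h x₀
    rw [ENNReal.tendsto_nhds_top_iff_nnreal]
    intro N
    -- An infimum of distances exceeding a bound need not exceed it strictly, hence `N + 1`.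
    obtain ⟨r, hr⟩ := (h (N + 1)).subset_ball x₀
    filter_upwards [eventually_ge_atTop r] with s hs
    refine lt_of_lt_of_le (b := ((N + 1 : NNReal) : ENNReal)) (by norm_cast; simp) ?_
    refine le_iInf₂ fun x hx => le_iInf₂ fun y hy => ?_
    by_contra hxy
    rw [not_le, edist_lt_coe, ← NNReal.coe_lt_coe, coe_nndist] at hxy
    exact hx.2 (ball_subset_ball hs (hr ⟨hx.1, y, hy.1, by simpa using hxy.le⟩))

namespace AsympDisjoint

variable {X : Type u} [MetricSpace X] {A B A' B' : Set X}

theorem bounded (h : AsympDisjoint A B) (R : ℝ) : IsBounded {x ∈ A | ∃ y ∈ B, dist x y ≤ R} :=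
  asympDisjoint_iff.1 h R

theorem mono (h : AsympDisjoint A B) (hA : A' ⊆ A) (hB : B' ⊆ B) : AsympDisjoint A' B' :=
  asympDisjoint_iff.2 fun R => (h.bounded R).subset
    fun _ ⟨hx, y, hy, hxy⟩ => ⟨hA hx, y, hB hy, hxy⟩

theorem symm (h : AsympDisjoint A B) : AsympDisjoint B A :=
  asympDisjoint_iff.2 fun R => ((h.bounded R).cthickening (δ := R)).subset
    fun y ⟨hy, x, hx, hxy⟩ => mem_cthickening_of_dist_le y x R _
      ⟨hx, y, hy, by rwa [dist_comm]⟩ hxy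

theorem isBounded_inter (h : AsympDisjoint A B) : IsBounded (A ∩ B) :=
  (h.bounded 0).subset fun x hx => ⟨hx.1, x, hx.2, by simp⟩

theorem union_right (h : AsympDisjoint A B) (h' : AsympDisjoint A B') :
    AsympDisjoint A (B ∪ B') :=
  asympDisjoint_iff.2 fun R => ((h.bounded R).union (h'.bounded R)).subset <| by
    rintro x ⟨hx, y, hy | hy, hxy⟩
    · exact Or.inl ⟨hx, y, hy, hxy⟩
    · exact Or.inr ⟨hx, y, hy, hxy⟩

theorem singleton_right (A : Set X) (z : X) : AsympDisjoint A {z} :=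
  asympDisjoint_iff.2 fun R => (isBounded_closedBall (x := z) (r := R)).subset <| by
    rintro x ⟨-, y, rfl, hxy⟩
    exact hxy

theorem insert_right (h : AsympDisjoint A B) (z : X) : AsympDisjoint A (insert z B) :=
  (singleton_right A z).union_right h

theorem insert_left (h : AsympDisjoint A B) (z : X) : AsympDisjoint (insert z A) B :=
  (h.symm.insert_right z).symm

/-- Points of `A` at bounded distance from `B` form a bounded set. -/
theorem bounded_infDist (h : AsympDisjoint A B) (hB : B.Nonempty) (R : ℝ) :
    IsBounded {x ∈ A | infDist x B ≤ R} :=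
  (h.bounded (R + 1)).subset fun x ⟨hx, hxR⟩ => by
    obtain ⟨y, hy, hxy⟩ := (infDist_lt_iff hB).1 (hxR.trans_lt (lt_add_one R))
    exact ⟨hx, y, hy, hxy.le⟩

end AsympDisjoint

theorem Isometry.asympDisjoint_image {X Y : Type u} [MetricSpace X] [MetricSpace Y] {f : X → Y}
    (hf : Isometry f) {A B : Set X} : AsympDisjoint (f '' A) (f '' B) ↔ AsympDisjoint A B := by
  have key : ∀ R : ℝ, {x ∈ f '' A | ∃ y ∈ f '' B, dist x y ≤ R} =
      f '' {x ∈ A | ∃ y ∈ B, dist x y ≤ R} := by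
    intro R
    ext x
    constructor
    · rintro ⟨⟨a, ha, rfl⟩, _, ⟨b, hb, rfl⟩, h⟩
      exact ⟨a, ⟨ha, b, hb, by rwa [hf.dist_eq] at h⟩, rfl⟩
    · rintro ⟨a, ⟨ha, b, hb, h⟩, rfl⟩
      exact ⟨⟨a, ha, rfl⟩, f b, ⟨b, hb, rfl⟩, by rwa [hf.dist_eq]⟩
  rw [asympDisjoint_iff, asympDisjoint_iff]
  refine forall_congr' fun R => ?_
  rw [key]
  refine ⟨fun h => ?_, fun h => hf.lipschitz.isBounded_image h⟩
  have := hf.antilipschitz.isBounded_preimage h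
  rwa [preimage_image_eq _ hf.injective] at this

/-! ### Traces in the Higson corona -/

section Corona

variable {X : Type u} [MetricSpace X]

theorem continuous_higsonMap : Continuous (higsonMap X) :=
  continuous_pi fun φ => φ.2.1

/-- Near `x` the function varies at rate at most `1 / w x`, and `w` exceeds any bound outside a
bounded set. -/
theorem slowlyOscillating_of_dist_le {φ : X → unitInterval} {w : X → ℝ}
    (hw : ∀ N : ℝ, IsBounded {x | w x ≤ N}) (h : ∀ x y, dist (φ y) (φ x) * w x ≤ dist y x) :
    SlowlyOscillating φ := by
  intro x₀ r hr ε hε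
  obtain ⟨D, hD0, hD⟩ := (hw (4 * r / ε)).subset_ball_lt 0 x₀
  refine ⟨D, hD0, fun x hx => ?_⟩
  have hwx : 4 * r / ε < w x := by
    by_contra hcon
    exact absurd (hD (show x ∈ {x | w x ≤ 4 * r / ε} from not_lt.1 hcon))
      (by rw [mem_ball, not_lt]; exact hx)
  have hpos : 0 < 4 * r / ε := by positivity
  have hb : ∀ y ∈ ball x r, dist (φ y) (φ x) ≤ ε / 4 := by
    intro y hy
    have h1 := h x y
    have h2 : dist y x < r := hy
    have h3 : 4 * r < w x * ε := (div_lt_iff₀ hε).1 hwx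
    by_contra hcon
    rw [not_le] at hcon
    nlinarith [mul_lt_mul_of_pos_right hcon (hpos.trans hwx)]
  refine lt_of_le_of_lt (b := ε / 2) (diam_le_of_forall_dist_le (by positivity) ?_) (by linarith)
  rintro _ ⟨y, hy, rfl⟩ _ ⟨z, hz, rfl⟩
  linarith [dist_triangle_right (φ y) (φ z) (φ x), hb y hy, hb z hz]

/-- A bump function with support the closed unit ball around `z`. -/
noncomputable def bump (z : X) (x : X) : unitInterval :=
  projIcc (0 : ℝ) 1 zero_le_one (1 - dist x z)

theorem bump_self (z : X) : bump z z = 1 := by simp [bump]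

theorem bump_eq_zero {x z : X} (h : 1 ≤ dist x z) : bump z x = 0 :=
  projIcc_of_le_left _ (by linarith)

theorem continuous_bump (z : X) : Continuous (bump z) :=
  continuous_projIcc.comp (by fun_prop)

theorem slowlyOscillating_bump (z : X) : SlowlyOscillating (bump z) := by
  intro x₀ r hr ε hε
  refine ⟨dist z x₀ + r + 1, by positivity, fun x hx => ?_⟩
  have : bump z '' ball x r ⊆ {0} := by
    rintro _ ⟨y, hy, rfl⟩
    refine bump_eq_zero ?_
    rw [mem_ball'] at hy
    linarith [dist_triangle4 x y z x₀]
  rwa [diam_subsingleton (subsingleton_singleton.anti this)]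

/-- The bump function as a member of `C_h(X)`. -/
noncomputable def bumpFun (z : X) : HigsonFun X :=
  ⟨bump z, continuous_bump z, slowlyOscillating_bump z⟩

theorem coronaTrace_mono {S T : Set X} (h : S ⊆ T) : coronaTrace S ⊆ coronaTrace T :=
  fun _ hp => closure_mono (image_mono h) hp

theorem coronaTrace_union (S T : Set X) :
    coronaTrace (S ∪ T) = coronaTrace S ∪ coronaTrace T := by
  ext p
  simp only [coronaTrace, image_union, closure_union, mem_ofPred_eq, mem_union]

theorem coronaTrace_univ : coronaTrace (univ : Set X) = univ := by
  ext p
  simpa [coronaTrace, image_univ] using! p.2.1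

theorem isClosed_coronaTrace (S : Set X) : IsClosed (coronaTrace S) :=
  isClosed_closure.preimage continuous_subtype_val

theorem closure_higsonMap_image_subset_range [ProperSpace X] {S : Set X} (hS : IsBounded S) :
    closure (higsonMap X '' S) ⊆ range (higsonMap X) := by
  have hc : IsCompact (higsonMap X '' closure S) :=
    hS.isCompact_closure.image continuous_higsonMap
  exact (closure_minimal (image_mono subset_closure) hc.isClosed).trans (image_subset_range _ _)

theorem coronaTrace_of_isBounded [ProperSpace X] {S : Set X} (hS : IsBounded S) :
    coronaTrace S = ∅ :=
  eq_empty_of_forall_notMem fun p hp => p.2.2 (closure_higsonMap_image_subset_range hS hp)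

/-- The corona is cut out of the compactification by the vanishing of all bump coordinates: a corona
point is not in the closure of a unit ball, while a point `z` of `X` has coordinate 1 at its own
bump. -/
theorem isClosed_higsonCorona [ProperSpace X] : IsClosed (higsonCorona X) := by
  have : higsonCorona X =
      higsonCompactification X ∩ ⋂ z : X, {p | p (bumpFun z) = 0} := by
    ext p
    refine ⟨fun hp => ⟨hp.1, mem_iInter.2 fun z => ?_⟩, fun hp => ⟨hp.1, ?_⟩⟩
    · by_contra hne
      have hcov : closure (range (higsonMap X)) ⊆
          {p | p (bumpFun z) = 0} ∪ closure (higsonMap X '' ball z 1) := by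
        refine closure_minimal ?_ ((isClosed_singleton.preimage
          (continuous_apply (bumpFun z))).union isClosed_closure)
        rintro _ ⟨x, rfl⟩
        rcases lt_or_ge (dist x z) 1 with hx | hx
        · exact Or.inr (subset_closure ⟨x, hx, rfl⟩)
        · exact Or.inl (bump_eq_zero hx)
      rcases hcov hp.1 with h | h
      · exact hne h
      · exact hp.2 (closure_higsonMap_image_subset_range isBounded_ball h)
    · rintro ⟨z, rfl⟩
      have := mem_iInter.1 hp.2 z
      exact one_ne_zero ((bump_self z).symm.trans this)
  rw [this]
  exact isClosed_closure.inter (isClosed_iInter fun z =>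
    isClosed_singleton.preimage (continuous_apply (bumpFun z)))

/-- Two sets at positive distance that are asymptotically disjoint are separated by a continuous
slowly oscillating function. -/
theorem exists_higsonFun_separating {A B : Set X} (hA : A.Nonempty) (hB : B.Nonempty)
    (h : AsympDisjoint A B) (h1 : ∀ a ∈ A, ∀ b ∈ B, 1 < dist a b) :
    ∃ φ : HigsonFun X, (∀ a ∈ A, φ.1 a = 0) ∧ ∀ b ∈ B, φ.1 b = 1 := by
  set w : X → ℝ := fun x => infDist x A + infDist x B with hw
  have hw1 : ∀ x, 1 ≤ w x := by
    intro x
    refine le_of_forall_pos_le_add fun ε hε => ?_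
    obtain ⟨a, ha, hxa⟩ := (infDist_lt_iff (x := x) hA).1 (lt_add_of_pos_right _ (half_pos hε))
    obtain ⟨b, hb, hxb⟩ := (infDist_lt_iff (x := x) hB).1 (lt_add_of_pos_right _ (half_pos hε))
    have := h1 a ha b hb
    have := dist_triangle_left a b x
    simp only [hw]
    linarith
  have hwpos : ∀ x, 0 < w x := fun x => zero_lt_one.trans_le (hw1 x)
  have hwb : ∀ N : ℝ, IsBounded {x | w x ≤ N} := by
    intro N
    refine ((h.bounded (2 * N + 2)).cthickening (δ := N + 1)).subset fun x hx => ?_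
    have hx : infDist x A + infDist x B ≤ N := hx
    have hA0 := infDist_nonneg (x := x) (s := A)
    have hB0 := infDist_nonneg (x := x) (s := B)
    obtain ⟨a, ha, hxa⟩ := (infDist_lt_iff (x := x) hA).1
      (show infDist x A < N + 1 by linarith)
    obtain ⟨b, hb, hxb⟩ := (infDist_lt_iff (x := x) hB).1
      (show infDist x B < N + 1 by linarith)
    refine mem_cthickening_of_dist_le x a _ _ ⟨ha, b, hb, ?_⟩ hxa.le
    linarith [dist_triangle_left a b x]
  have hmem : ∀ x, infDist x A / w x ∈ unitInterval := fun x =>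
    ⟨div_nonneg infDist_nonneg (hwpos x).le,
      (div_le_one (hwpos x)).2 (le_add_of_nonneg_right infDist_nonneg)⟩
  have hcont : Continuous fun x => infDist x A / w x :=
    (continuous_infDist_pt A).div ((continuous_infDist_pt A).add (continuous_infDist_pt B))
      fun x => (hwpos x).ne'
  refine ⟨⟨fun x => ⟨infDist x A / w x, hmem x⟩, hcont.subtype_mk _,
    slowlyOscillating_of_dist_le hwb fun x y => ?_⟩, fun a ha => ?_, fun b hb => ?_⟩
  · rw [Subtype.dist_eq, Real.dist_eq]
    have hx := hwpos x
    have hy := hwpos y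
    -- The numerator of this form is at most `dist y x * w y`, so `w y` cancels and only the weight
    -- `w x` remains.
    rw [show infDist y A / w y - infDist x A / w x =
      ((infDist y A) * (infDist x B - infDist y B) + infDist y B * (infDist y A - infDist x A)) /
        (w y * w x) by field_simp; simp only [hw]; ring]
    rw [abs_div, abs_of_pos (mul_pos hy hx), div_mul_eq_mul_div, div_le_iff₀ (mul_pos hy hx)]
    have e1 : |infDist x B - infDist y B| ≤ dist y x := by
      rw [abs_sub_comm, ← Real.dist_eq]
      simpa using (lipschitz_infDist_pt B).dist_le_mul y x
    have e2 : |infDist y A - infDist x A| ≤ dist y x := by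
      rw [← Real.dist_eq]
      simpa using (lipschitz_infDist_pt A).dist_le_mul y x
    have e3 : |infDist y A * (infDist x B - infDist y B) +
        infDist y B * (infDist y A - infDist x A)| ≤ dist y x * w y := by
      refine (abs_add_le _ _).trans ?_
      rw [abs_mul, abs_mul, abs_of_nonneg infDist_nonneg, abs_of_nonneg infDist_nonneg]
      have := mul_le_mul_of_nonneg_left e1 (infDist_nonneg (x := y) (s := A))
      have := mul_le_mul_of_nonneg_left e2 (infDist_nonneg (x := y) (s := B))
      simp only [hw]
      linarith
    calc _ ≤ dist y x * w y * w x := mul_le_mul_of_nonneg_right e3 hx.le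
      _ = _ := by ring
  · ext
    simp [infDist_zero_of_mem ha]
  · ext
    have : w b = infDist b A := by simp [hw, infDist_zero_of_mem hb]
    simp only [this]
    exact div_self (this ▸ (hwpos b).ne')

theorem AsympDisjoint.disjoint_coronaTrace [ProperSpace X] {A B : Set X}
    (h : AsympDisjoint A B) : Disjoint (coronaTrace A) (coronaTrace B) := by
  -- Discarding this bounded set does not change the trace and leaves the gap greater than 1 that
  -- the separating function needs.
  set S := {x ∈ A | ∃ y ∈ B, dist x y ≤ 1} with hS
  have hA : coronaTrace A ⊆ coronaTrace (A \ S) := by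
    have := coronaTrace_union S (A \ S)
    rw [union_sdiff_cancel (sep_subset _ _), coronaTrace_of_isBounded (h.bounded 1),
      empty_union] at this
    exact this.le
  refine Disjoint.mono_left hA ?_
  rcases (A \ S).eq_empty_or_nonempty with he | hne
  · rw [he, coronaTrace_of_isBounded isBounded_empty]
    exact empty_disjoint _
  rcases B.eq_empty_or_nonempty with he | hneB
  · rw [he, coronaTrace_of_isBounded isBounded_empty]
    exact disjoint_empty _
  obtain ⟨φ, h0, h1⟩ := exists_higsonFun_separating hne hneB (h.mono sdiff_subset subset_rfl)
    fun a ha b hb => not_le.1 fun hab => ha.2 ⟨ha.1, b, hb, hab⟩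
  refine disjoint_left.2 fun p hpA hpB => ?_
  have e0 : p.1 φ = 0 := closure_minimal (t := (fun q : HigsonFun X → unitInterval => q φ) ⁻¹' {0})
    (by rintro _ ⟨a, ha, rfl⟩; exact h0 a ha)
    (isClosed_singleton.preimage (continuous_apply φ)) hpA
  have e1 : p.1 φ = 1 := closure_minimal (t := (fun q : HigsonFun X → unitInterval => q φ) ⁻¹' {1})
    (by rintro _ ⟨a, ha, rfl⟩; exact h1 a ha)
    (isClosed_singleton.preimage (continuous_apply φ)) hpB
  exact zero_ne_one (e0.symm.trans e1)

/-- If unboundedly many points of `A` have a partner in `B` within `R`, an ultrafilter on them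
tending to infinity converges in the cube. Slow oscillation gives the partners the same limit, which
is then a corona point in both traces. -/
theorem asympDisjoint_of_disjoint_coronaTrace {A B : Set X}
    (h : Disjoint (coronaTrace A) (coronaTrace B)) : AsympDisjoint A B := by
  refine asympDisjoint_iff.2 fun R => ?_
  by_contra hS
  set S := {x ∈ A | ∃ y ∈ B, dist x y ≤ R}
  have hne : (cobounded X ⊓ 𝓟 S).NeBot := by
    refine ⟨fun hbot => hS ?_⟩
    rw [← disjoint_iff, disjoint_principal_right] at hbot
    exact isBounded_def.2 hbot
  have hcob : (Ultrafilter.of (cobounded X ⊓ 𝓟 S) : Filter X) ≤ cobounded X :=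
    (Ultrafilter.of_le _).trans inf_le_left
  have hmem : ∀ᶠ x in (Ultrafilter.of (cobounded X ⊓ 𝓟 S) : Filter X), x ∈ S :=
    ((Ultrafilter.of_le _).trans inf_le_right) (mem_principal_self S)
  set 𝒢 := Ultrafilter.of (cobounded X ⊓ 𝓟 S)
  obtain ⟨p, -, hp⟩ := isCompact_univ.ultrafilter_le_nhds (𝒢.map (higsonMap X)) (by simp)
  have hp : Tendsto (higsonMap X) 𝒢 (𝓝 p) := hp
  choose! g hgB hgR using fun x (hx : x ∈ S) => hx.2
  have hpA : p ∈ closure (higsonMap X '' A) :=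
    mem_closure_of_tendsto hp (hmem.mono fun x hx => ⟨x, hx.1, rfl⟩)
  have hR : 0 ≤ R := by
    obtain ⟨x, hx⟩ := hmem.exists
    exact dist_nonneg.trans (hgR x hx)
  have hpB : p ∈ closure (higsonMap X '' B) := by
    refine mem_closure_of_tendsto (f := fun x => higsonMap X (g x)) (b := (𝒢 : Filter X)) ?_
      (hmem.mono fun x hx => ⟨g x, hgB x hx, rfl⟩)
    rw [tendsto_pi_nhds] at hp ⊢
    intro φ
    refine tendsto_of_tendsto_of_dist (hp φ) (Metric.tendsto_nhds.2 fun ε hε => ?_)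
    obtain ⟨x₀, -⟩ := hmem.exists
    obtain ⟨D, -, hD⟩ := φ.2.2 x₀ (R + 1) (by linarith) ε hε
    have hfar : ∀ᶠ x in (𝒢 : Filter X), x ∉ ball x₀ D :=
      hcob (isBounded_def.1 isBounded_ball)
    filter_upwards [hmem, hfar] with x hx hxD
    rw [Real.dist_0_eq_abs, abs_of_nonneg dist_nonneg]
    refine lt_of_le_of_lt (dist_le_diam_of_mem ?_ ?_ ?_) (hD x (by simpa using hxD))
    -- Boundedness matters because `Metric.diam` of an unbounded set is 0.
    · exact isCompact_univ.isBounded.subset (subset_univ _)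
    · exact ⟨x, mem_ball_self (by linarith), rfl⟩
    · exact ⟨g x, by rw [mem_ball']; linarith [hgR x hx], rfl⟩
  have hpν : p ∈ higsonCorona X := by
    refine ⟨closure_mono (image_subset_range _ _) hpA, ?_⟩
    rintro ⟨z, rfl⟩
    have hfar : ∀ᶠ x in (𝒢 : Filter X), x ∉ ball z 1 := hcob (isBounded_def.1 isBounded_ball)
    have h0 : Tendsto (fun x => higsonMap X x (bumpFun z)) 𝒢 (𝓝 0) :=
      tendsto_const_nhds.congr' (hfar.mono fun x hx => (bump_eq_zero (by simpa using hx)).symm)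
    exact one_ne_zero ((bump_self z).symm.trans
      (tendsto_nhds_unique (tendsto_pi_nhds.1 hp (bumpFun z)) h0))
  have hpA' : (⟨p, hpν⟩ : higsonCorona X) ∈ coronaTrace A := hpA
  exact disjoint_left.1 h hpA' hpB

/-- By regularity of the cube, each corona point has a basis of neighbourhoods given by traces of
subsets of `X`. -/
theorem exists_coronaTrace_subset {O : Set (higsonCorona X)} (hO : IsOpen O)
    {p : higsonCorona X} (hp : p ∈ O) :
    ∃ S : Set X, p ∉ coronaTrace Sᶜ ∧ coronaTrace S ⊆ O := by
  obtain ⟨O', hO', rfl⟩ := isOpen_induced_iff.1 hO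
  obtain ⟨N, hpN, hNc, hNO⟩ := exists_mem_nhds_isClosed_subset (hO'.mem_nhds hp)
  refine ⟨higsonMap X ⁻¹' N, fun hq => ?_, fun q hq => hNO ?_⟩
  · obtain ⟨_, hxN, x, hx, rfl⟩ := mem_closure_iff_nhds.1 hq N hpN
    exact hx hxN
  · exact closure_minimal (image_preimage_subset _ _) hNc hq

end Corona

/-! ### Separators described without the corona -/

/-- A separation of `A` from `B` off `C`, given by two families of subsets of `X`, those lying
asymptotically on the side of `A` and those lying asymptotically on the side of `B`. -/
structure AsympSeparation {X : Type u} [MetricSpace X] (A B C : Set X) (𝓤 𝓥 : Set (Set X)) :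
    Prop where
  disj : ∀ S ∈ 𝓤, ∀ T ∈ 𝓥, AsympDisjoint S T
  disj_left : ∀ S ∈ 𝓤, AsympDisjoint S C
  disj_right : ∀ S ∈ 𝓥, AsympDisjoint S C
  anti_left : ∀ S ∈ 𝓤, ∀ T ⊆ S, T ∈ 𝓤
  anti_right : ∀ S ∈ 𝓥, ∀ T ⊆ S, T ∈ 𝓥
  cover : ∀ S, AsympDisjoint S C → ∃ S₁ ∈ 𝓤, ∃ S₂ ∈ 𝓥, S = S₁ ∪ S₂
  mem_left : A ∈ 𝓤
  mem_right : B ∈ 𝓥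

theorem IsAsympSeparator.exists_asympSeparation {X : Type u} [MetricSpace X] [ProperSpace X]
    {A B C : Set X} (h : IsAsympSeparator A B C) :
    ∃ 𝓤 𝓥 : Set (Set X), AsympSeparation A B C 𝓤 𝓥 := by
  obtain ⟨-, U, V, hU, hV, hUV, hC, hA, hB⟩ := h
  have hUC : Disjoint U (coronaTrace C) :=
    disjoint_left.2 fun p hp hpC => (hC ▸ Or.inl hp : p ∈ (coronaTrace C)ᶜ) hpC
  have hVC : Disjoint V (coronaTrace C) :=
    disjoint_left.2 fun p hp hpC => (hC ▸ Or.inr hp : p ∈ (coronaTrace C)ᶜ) hpC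
  refine ⟨{S | coronaTrace S ⊆ U}, {S | coronaTrace S ⊆ V}, ⟨?_, ?_, ?_, ?_, ?_, ?_, hA, hB⟩⟩
  · exact fun S hS T hT => asympDisjoint_of_disjoint_coronaTrace (hUV.mono hS hT)
  · exact fun S hS => asympDisjoint_of_disjoint_coronaTrace (hUC.mono_left hS)
  · exact fun S hS => asympDisjoint_of_disjoint_coronaTrace (hVC.mono_left hS)
  · exact fun S hS T hT => (coronaTrace_mono hT).trans hS
  · exact fun S hS T hT => (coronaTrace_mono hT).trans hS
  · intro S hS
    have hSUV : coronaTrace S ⊆ U ∪ V := by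
      rw [← hC]
      exact hS.disjoint_coronaTrace.subset_compl_right
    -- The parts of the trace of `S` outside `V` and outside `U` are disjoint and closed in the
    -- cube. Normality gives an open `O` around the first whose closure misses the second, and `S`
    -- is cut along `O`.
    have hemb := (isClosed_higsonCorona (X := X)).isClosedEmbedding_subtypeVal
    have hK₁ := hemb.isClosedMap _ ((isClosed_coronaTrace S).sdiff hV)
    have hK₂ := hemb.isClosedMap _ ((isClosed_coronaTrace S).sdiff hU)
    have hK : Subtype.val '' (coronaTrace S \ V) ⊆ (Subtype.val '' (coronaTrace S \ U))ᶜ := by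
      rintro _ ⟨p, ⟨hp, hpV⟩, rfl⟩ ⟨q, ⟨hq, hqU⟩, hqp⟩
      obtain rfl := Subtype.ext hqp
      exact (hSUV hp).elim hqU hpV
    obtain ⟨O, hO, hKO, hOK⟩ := normal_exists_closure_subset hK₁ hK₂.isOpen_compl hK
    refine ⟨S ∩ higsonMap X ⁻¹' O, fun p hp => ?_, S \ higsonMap X ⁻¹' O, fun p hp => ?_,
      (inter_union_sdiff _ _).symm⟩
    · by_contra hpU
      have hpO : (p : HigsonFun X → unitInterval) ∈ closure O :=
        closure_mono (image_subset_iff.2 inter_subset_right) hp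
      exact hOK hpO ⟨p, ⟨coronaTrace_mono inter_subset_left hp, hpU⟩, rfl⟩
    · by_contra hpV
      have hpO : (p : HigsonFun X → unitInterval) ∈ Oᶜ :=
        closure_minimal (by rintro _ ⟨x, hx, rfl⟩; exact hx.2) hO.isClosed_compl hp
      exact hpO (hKO ⟨p, ⟨coronaTrace_mono sdiff_subset hp, hpV⟩, rfl⟩)

theorem AsympSeparation.isAsympSeparator {X : Type u} [MetricSpace X] [ProperSpace X]
    {A B C : Set X} {𝓤 𝓥 : Set (Set X)} (h : AsympSeparation A B C 𝓤 𝓥) (hC : IsClosed C) :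
    IsAsympSeparator A B C := by
  have hint : ∀ {S : Set X} {p : higsonCorona X}, p ∉ coronaTrace Sᶜ → p ∈ coronaTrace S := by
    intro S p hp
    have : p ∈ coronaTrace (S ∪ Sᶜ) := by rw [union_compl_self, coronaTrace_univ]; trivial
    rw [coronaTrace_union] at this
    exact this.resolve_right hp
  -- The complement of the trace of `Sᶜ` serves as an open kernel of the trace of `S`; the two open
  -- sides are unions of these.
  have hopen : ∀ 𝓢 : Set (Set X), IsOpen (⋃ S ∈ 𝓢, (coronaTrace Sᶜ)ᶜ) := fun 𝓢 =>
    isOpen_biUnion fun S _ => (isClosed_coronaTrace _).isOpen_compl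
  have hdisj : Disjoint (⋃ S ∈ 𝓤, (coronaTrace Sᶜ)ᶜ) (⋃ S ∈ 𝓥, (coronaTrace Sᶜ)ᶜ) := by
    refine disjoint_left.2 fun p hp hq => ?_
    obtain ⟨S, hS, hpS⟩ := mem_iUnion₂.1 hp
    obtain ⟨T, hT, hpT⟩ := mem_iUnion₂.1 hq
    exact disjoint_left.1 (h.disj S hS T hT).disjoint_coronaTrace (hint hpS) (hint hpT)
  have hcompl : (coronaTrace C)ᶜ =
      (⋃ S ∈ 𝓤, (coronaTrace Sᶜ)ᶜ) ∪ ⋃ S ∈ 𝓥, (coronaTrace Sᶜ)ᶜ := by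
    refine Subset.antisymm (fun p hp => ?_) (union_subset ?_ ?_)
    · obtain ⟨S, hpS, hSC⟩ := exists_coronaTrace_subset (isClosed_coronaTrace C).isOpen_compl hp
      obtain ⟨S₁, h₁, S₂, h₂, rfl⟩ :=
        h.cover S (asympDisjoint_of_disjoint_coronaTrace (subset_compl_iff_disjoint_right.1 hSC))
      have hd := (h.disj _ h₁ _ h₂).disjoint_coronaTrace
      by_cases hp2 : p ∈ coronaTrace S₂
      · refine Or.inr (mem_iUnion₂.2 ⟨S₂, h₂, fun hq => ?_⟩)
        have : S₂ᶜ ⊆ (S₁ ∪ S₂)ᶜ ∪ S₁ := by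
          intro x hx; by_cases hx1 : x ∈ S₁ <;> simp_all
        have := coronaTrace_mono this hq
        rw [coronaTrace_union] at this
        exact this.elim hpS fun hp1 => disjoint_left.1 hd hp1 hp2
      · refine Or.inl (mem_iUnion₂.2 ⟨S₁, h₁, fun hq => ?_⟩)
        have : S₁ᶜ ⊆ (S₁ ∪ S₂)ᶜ ∪ S₂ := by
          intro x hx; by_cases hx1 : x ∈ S₂ <;> simp_all
        have := coronaTrace_mono this hq
        rw [coronaTrace_union] at this
        exact this.elim hpS hp2
    · exact iUnion₂_subset fun S hS p hp =>
        disjoint_left.1 (h.disj_left S hS).disjoint_coronaTrace (hint hp)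
    · exact iUnion₂_subset fun S hS p hp =>
        disjoint_left.1 (h.disj_right S hS).disjoint_coronaTrace (hint hp)
  refine ⟨hC, _, _, hopen 𝓤, hopen 𝓥, hdisj, hcompl, fun p hp => ?_, fun p hp => ?_⟩
  · have hpC : p ∈ (coronaTrace C)ᶜ :=
      disjoint_left.1 (h.disj_left A h.mem_left).disjoint_coronaTrace hp
    rw [hcompl] at hpC
    refine hpC.resolve_right fun hq => ?_
    obtain ⟨T, hT, hpT⟩ := mem_iUnion₂.1 hq
    exact disjoint_left.1 (h.disj A h.mem_left T hT).disjoint_coronaTrace hp (hint hpT)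
  · have hpC : p ∈ (coronaTrace C)ᶜ :=
      disjoint_left.1 (h.disj_right B h.mem_right).disjoint_coronaTrace hp
    rw [hcompl] at hpC
    refine hpC.resolve_left fun hq => ?_
    obtain ⟨S, hS, hpS⟩ := mem_iUnion₂.1 hq
    exact disjoint_left.1 (h.disj S hS B h.mem_right).disjoint_coronaTrace (hint hpS) hp

/-! ### Invariance of the dimension under isometries -/

theorem IsometryEquiv.asympDisjoint_preimage {X Y : Type u} [MetricSpace X] [MetricSpace Y]
    (e : X ≃ᵢ Y) {A B : Set Y} : AsympDisjoint (e ⁻¹' A) (e ⁻¹' B) ↔ AsympDisjoint A B := by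
  rw [← e.image_symm]
  exact e.symm.isometry.asympDisjoint_image

theorem AsympSeparation.image {X Y : Type u} [MetricSpace X] [MetricSpace Y] (e : X ≃ᵢ Y)
    {A B : Set Y} {C : Set X} {𝓤 𝓥 : Set (Set X)}
    (h : AsympSeparation (e ⁻¹' A) (e ⁻¹' B) C 𝓤 𝓥) :
    AsympSeparation A B (e '' C) {S | e ⁻¹' S ∈ 𝓤} {S | e ⁻¹' S ∈ 𝓥} := by
  have hC : e ⁻¹' (e '' C) = C := preimage_image_eq _ e.injective
  refine ⟨?_, ?_, ?_, ?_, ?_, ?_, h.mem_left, h.mem_right⟩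
  · exact fun S hS T hT => e.asympDisjoint_preimage.1 (h.disj _ hS _ hT)
  · exact fun S hS => e.asympDisjoint_preimage.1 (by rw [hC]; exact h.disj_left _ hS)
  · exact fun S hS => e.asympDisjoint_preimage.1 (by rw [hC]; exact h.disj_right _ hS)
  · exact fun S hS T hT => h.anti_left _ hS _ (preimage_mono hT)
  · exact fun S hS T hT => h.anti_right _ hS _ (preimage_mono hT)
  · intro S hS
    have hS := e.asympDisjoint_preimage.2 hS
    rw [hC] at hS
    obtain ⟨S₁, h₁, S₂, h₂, hSS⟩ := h.cover _ hS
    refine ⟨e '' S₁, ?_, e '' S₂, ?_, ?_⟩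
    · simpa only [mem_ofPred_eq, preimage_image_eq _ e.injective] using h₁
    · simpa only [mem_ofPred_eq, preimage_image_eq _ e.injective] using h₂
    · rw [← image_union, ← hSS, image_preimage_eq _ e.surjective]

/-- An isometric embedding restricts to an isometry of a subset onto its image. -/
noncomputable def Isometry.isometryEquivImage {X Y : Type u} [MetricSpace X] [MetricSpace Y]
    {f : X → Y} (hf : Isometry f) (C : Set X) : C ≃ᵢ f '' C where
  toEquiv := Equiv.Set.image f C hf.injective
  isometry_toFun := fun x y => hf x y

/-- Needed because a separator inside the kernel and its copy in `X` are different spaces.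
Separations transport since asymptotic disjointness does, without comparing the two coronas. -/
theorem AsIndLT.congr {n : ℕ} {X Y : Type u} [MetricSpace X] [MetricSpace Y] [ProperSpace X]
    (e : X ≃ᵢ Y) (h : AsIndLT n X) : AsIndLT n Y := by
  induction n generalizing X Y with
  | zero =>
    have h : IsBounded (univ : Set X) := h
    have := e.isometry.lipschitz.isBounded_image h
    rwa [image_univ, e.range_eq_univ] at this
  | succ n ih =>
    intro A B hAB
    have : ProperSpace Y := e.isometry.antilipschitz.properSpace e.continuous e.surjective
    obtain ⟨C, hC, hCn⟩ := h _ _ (e.asympDisjoint_preimage.2 hAB)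
    have : ProperSpace C := ProperSpace.of_isClosed hC.1
    obtain ⟨𝓤, 𝓥, hs⟩ := hC.exists_asympSeparation
    exact ⟨e '' C, (hs.image e).isAsympSeparator (e.toHomeomorph.isClosedMap _ hC.1),
      ih (e.isometry.isometryEquivImage C) hCn⟩

/-! ### Extending a separation along nearest points -/

/-- The points of `Y` that are much closer to `A` than to `B`. -/
def closerPart {X : Type u} [MetricSpace X] (Y A B : Set X) : Set Y :=
  {y | 3 * infDist (y : X) A ≤ infDist (y : X) B}

/-- Two points within `R` with opposite preferences are both within a multiple of `R` of `A` and of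
`B`. Any factor greater than 1 in place of 3 would work, with other constants. -/
theorem asympDisjoint_closerPart {X : Type u} [MetricSpace X] {Y A B : Set X}
    (h : AsympDisjoint A B) (hA : A.Nonempty) (hB : B.Nonempty) :
    AsympDisjoint (closerPart Y A B) (closerPart Y B A) := by
  refine asympDisjoint_iff.2 fun R => isBounded_image_subtype_val.1 ?_
  refine ((h.bounded (3 * R + 2)).cthickening (δ := R + 1)).subset ?_
  rintro _ ⟨y, ⟨hy, z, hz, hyz⟩, rfl⟩
  have hy : 3 * infDist (y : X) A ≤ infDist (y : X) B := hy
  have hz : 3 * infDist (z : X) B ≤ infDist (z : X) A := hz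
  have hyz : dist (y : X) z ≤ R := hyz
  have h1 := infDist_le_infDist_add_dist (s := B) (x := (y : X)) (y := z)
  have h2 := infDist_le_infDist_add_dist (s := A) (x := (z : X)) (y := y)
  rw [dist_comm] at h2
  have hR : 0 ≤ R := dist_nonneg.trans hyz
  obtain ⟨a, ha, hya⟩ := (infDist_lt_iff (x := (y : X)) hA).1
    (show infDist (y : X) A < R + 1 by linarith)
  obtain ⟨b, hb, hyb⟩ := (infDist_lt_iff (x := (y : X)) hB).1
    (show infDist (y : X) B < 2 * R + 1 by linarith)
  refine mem_cthickening_of_dist_le _ a _ _ ⟨ha, b, hb, ?_⟩ hya.le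
  linarith [dist_triangle_left a b (y : X)]

theorem infDist_le_of_notMem_closerPart {X : Type u} [MetricSpace X] {Y A B : Set X} {x : X}
    {y : Y} (hx : x ∈ A) (hy : y ∉ closerPart Y A B) : infDist x B ≤ 4 * dist x y := by
  have hy : infDist (y : X) B < 3 * infDist (y : X) A := not_le.1 hy
  have h1 := infDist_le_infDist_add_dist (s := B) (x := x) (y := y)
  have h2 := infDist_le_dist_of_mem (x := (y : X)) hx
  rw [dist_comm] at h2
  linarith

/-- A set whose part over `Y` is asymptotically disjoint from `C ⊆ Y` is itself so. -/
theorem asympDisjoint_of_closerPart {X : Type u} [MetricSpace X] {Y A B : Set X} {p : X → Y}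
    (hp : ∀ (x : X) (y : Y), dist x (p x) ≤ dist x y) (h : AsympDisjoint A B) (hB : B.Nonempty)
    {C : Set Y} (hC : AsympDisjoint (closerPart Y A B) C) :
    AsympDisjoint A (Subtype.val '' C) := by
  refine asympDisjoint_iff.2 fun R => ?_
  refine ((h.bounded_infDist hB (4 * R)).union
    ((isBounded_image_subtype_val.2 (hC.bounded (2 * R))).cthickening (δ := R))).subset ?_
  rintro x ⟨hx, _, ⟨z, hz, rfl⟩, hxz⟩
  have hxp := (hp x z).trans hxz
  by_cases hpx : p x ∈ closerPart Y A B
  · refine Or.inr (mem_cthickening_of_dist_le x (p x) _ _ ⟨p x, ⟨hpx, z, hz, ?_⟩, rfl⟩ hxp)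
    rw [Subtype.dist_eq]
    linarith [dist_triangle_left (p x : X) z x]
  · exact Or.inl ⟨hx, (infDist_le_of_notMem_closerPart hx hpx).trans (by linarith)⟩

/-- If the points far from `Y` are increasingly isolated, then an asymptotic separation in `Y` of
neighbourhoods of the traces of `A` and `B` extends to an asymptotic separation of `A` and `B` in
`X`: a point close to `Y` relative to its distance to `C` goes to the side of its nearest point in
`Y`, the others can be distributed freely. -/
theorem AsympSeparation.extend {X : Type u} [MetricSpace X] {Y A B : Set X} {p : X → Y}
    (hp : ∀ (x : X) (y : Y), dist x (p x) ≤ dist x y)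
    (hiso : ∀ R : ℝ, ∃ D : ℝ, ∀ x y : X, D < dist x (p x) → dist x y ≤ R → x = y)
    (hAB : AsympDisjoint A B) (hA : A.Nonempty) (hB : B.Nonempty) (y₀ : Y) {C : Set Y}
    {𝓤 𝓥 : Set (Set Y)} (h : AsympSeparation (closerPart Y A B) (closerPart Y B A) C 𝓤 𝓥) :
    ∃ 𝓤' 𝓥' : Set (Set X), AsympSeparation A B (Subtype.val '' C) 𝓤' 𝓥' := by
  -- Adding `y₀` avoids the value 0 of `infDist` for empty `C` and bounds `c y` by the distance to
  -- `y₀`, which `hpull` uses.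
  set c : Y → ℝ := fun y => infDist y (insert y₀ C) with hc
  set F : Set X := {x | c (p x) < dist x (p x)} with hF
  set EA : Set X := {x ∈ A | x ∈ F ∨ p x ∉ closerPart Y A B} with hEA
  set EB : Set X := {x ∈ B | x ∈ F ∨ p x ∉ closerPart Y B A} with hEB
  set G : Set X := F ∪ EA ∪ EB with hG
  have hcC : ∀ R : ℝ, ∀ y : Y, c y ≤ R → ∃ z ∈ insert y₀ C, dist y z ≤ R + 1 := by
    intro R y hy
    obtain ⟨z, hz, hyz⟩ := (infDist_lt_iff (insert_nonempty y₀ C)).1 (hy.trans_lt (lt_add_one R))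
    exact ⟨z, hz, hyz.le⟩
  have hins : ∀ {S : Set X}, AsympDisjoint S (Subtype.val '' C) →
      AsympDisjoint S (Subtype.val '' insert y₀ C) := by
    intro S hS
    rw [image_insert_eq]
    exact hS.insert_right _
  have hnear : ∀ {S : Set X}, AsympDisjoint S (Subtype.val '' C) → ∀ R : ℝ,
      IsBounded {x ∈ S | dist x (p x) ≤ R ∧ c (p x) ≤ R} := by
    intro S hS R
    refine ((hins hS).bounded (2 * R + 1)).subset ?_
    rintro x ⟨hx, hxp, hcx⟩
    obtain ⟨z, hz, hyz⟩ := hcC R _ hcx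
    refine ⟨hx, z, ⟨z, hz, rfl⟩, ?_⟩
    have hyz : dist (p x : X) z ≤ R + 1 := hyz
    linarith [dist_triangle x (p x) z]
  -- On `F`, `c (p x)` is also at most `R`, so `hnear` applies; a point of `EA` or `EB` outside `F`
  -- is within `4 * R` of the opposite set.
  have hfar : ∀ {S : Set X}, AsympDisjoint S (Subtype.val '' C) → ∀ R : ℝ,
      IsBounded {x ∈ S ∩ G | dist x (p x) ≤ R} := by
    intro S hS R
    refine (((hnear hS R).union (hAB.bounded_infDist hB (4 * R))).union
      (hAB.symm.bounded_infDist hA (4 * R))).subset ?_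
    rintro x ⟨⟨hxS, hxG⟩, hxR⟩
    by_cases hxF : x ∈ F
    · exact Or.inl (Or.inl ⟨hxS, hxR, (show c (p x) < _ from hxF).le.trans hxR⟩)
    rcases hxG with (hx | ⟨hx, hx'⟩) | ⟨hx, hx'⟩
    · exact absurd hx hxF
    · exact Or.inl (Or.inr ⟨hx, (infDist_le_of_notMem_closerPart hx
        (hx'.resolve_left hxF)).trans (by linarith)⟩)
    · exact Or.inr ⟨hx, (infDist_le_of_notMem_closerPart hx
        (hx'.resolve_left hxF)).trans (by linarith)⟩
  have hisolated : ∀ {S : Set X}, AsympDisjoint S (Subtype.val '' C) → ∀ R : ℝ,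
      IsBounded {x ∈ S ∩ G | ∃ y, y ≠ x ∧ dist x y ≤ R} := by
    intro S hS R
    obtain ⟨D, hD⟩ := hiso R
    refine (hfar hS D).subset ?_
    rintro x ⟨hx, y, hne, hxy⟩
    exact ⟨hx, not_lt.1 fun hlt => hne (hD x y hlt hxy).symm⟩
  have hpull : ∀ {T : Set Y}, IsBounded T → IsBounded {x | x ∉ G ∧ p x ∈ T} := by
    intro T hT
    obtain ⟨r, hr⟩ := hT.subset_ball y₀
    refine (isBounded_closedBall (x := (y₀ : X)) (r := 2 * r)).subset ?_
    rintro x ⟨hxG, hxT⟩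
    have h1 : dist (p x : X) y₀ < r := hr hxT
    have h2 : dist x (p x) ≤ c (p x) := not_lt.1 fun hx => hxG (Or.inl (Or.inl hx))
    have h3 : c (p x) ≤ dist (p x : X) y₀ := infDist_le_dist_of_mem (mem_insert y₀ C)
    rw [mem_closedBall]
    linarith [dist_triangle x (p x) y₀]
  have hAC : AsympDisjoint A (Subtype.val '' C) :=
    asympDisjoint_of_closerPart hp hAB hB (h.disj_left _ h.mem_left)
  have hBC : AsympDisjoint B (Subtype.val '' C) :=
    asympDisjoint_of_closerPart hp hAB.symm hA (h.disj_right _ h.mem_right)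
  -- Outside `G` a point follows its image under `p`; within `G`, up to bounded sets, `EA` goes left
  -- and everything else right.
  refine ⟨{S | AsympDisjoint S (Subtype.val '' C) ∧ p '' (S \ G) ∈ 𝓤 ∧
      IsBounded (S ∩ (G \ EA))},
    {S | AsympDisjoint S (Subtype.val '' C) ∧ p '' (S \ G) ∈ 𝓥 ∧ IsBounded (S ∩ EA)},
    ⟨?_, fun S hS => hS.1, fun S hS => hS.1, ?_, ?_, ?_, ⟨hAC, ?_, ?_⟩, ⟨hBC, ?_, ?_⟩⟩⟩
  · rintro S ⟨hSC, hSU, hSb⟩ T ⟨hTC, hTV, hTb⟩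
    have hd := h.disj _ hSU _ hTV
    refine asympDisjoint_iff.2 fun R => ?_
    obtain ⟨D, hD⟩ := hiso R
    refine (((((hisolated hSC R).union ((hisolated hTC R).cthickening (δ := R))).union hSb).union
      hTb).union ((hpull hd.isBounded_inter).union
        (hpull (hd.bounded (2 * D + 2 * R))))).subset ?_
    rintro x ⟨hxS, y, hyT, hxy⟩
    have hEG : EA ⊆ G := fun z hz => Or.inl (Or.inr hz)
    by_cases hxy' : x = y
    · subst hxy'
      by_cases hxE : x ∈ EA
      · exact Or.inl (Or.inr ⟨hyT, hxE⟩)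
      by_cases hxG : x ∈ G
      · exact Or.inl (Or.inl (Or.inr ⟨hxS, hxG, hxE⟩))
      exact Or.inr (Or.inl ⟨hxG, mem_image_of_mem p ⟨hxS, hxG⟩, mem_image_of_mem p ⟨hyT, hxG⟩⟩)
    by_cases hxG : x ∈ G
    · exact Or.inl (Or.inl (Or.inl (Or.inl ⟨⟨hxS, hxG⟩, y, Ne.symm hxy', hxy⟩)))
    by_cases hyG : y ∈ G
    · exact Or.inl (Or.inl (Or.inl (Or.inr (mem_cthickening_of_dist_le x y _ _
        ⟨⟨hyT, hyG⟩, x, hxy', by rwa [dist_comm]⟩ hxy))))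
    refine Or.inr (Or.inr ⟨hxG, mem_image_of_mem p ⟨hxS, hxG⟩, p y,
      mem_image_of_mem p ⟨hyT, hyG⟩, ?_⟩)
    -- As `x` has another point within `R`, it is within `D` of `Y`; then `y` is within `D + R` of
    -- `Y`, so the nearest points are within `2 * D + 2 * R`.
    have h1 : dist x (p x) ≤ D := not_lt.1 fun hlt => hxy' (hD x y hlt hxy)
    have h2 := hp y (p x)
    have h3 := dist_triangle y x (p x : X)
    have h4 := dist_triangle4 (p x : X) x y (p y)
    rw [dist_comm y x] at h3
    rw [dist_comm (p x : X) x] at h4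
    rw [Subtype.dist_eq]
    linarith
  · rintro S ⟨h1, h2, h3⟩ T hT
    exact ⟨h1.mono hT subset_rfl, h.anti_left _ h2 _ (image_mono (sdiff_subset_sdiff_left hT)),
      h3.subset (inter_subset_inter_left _ hT)⟩
  · rintro S ⟨h1, h2, h3⟩ T hT
    exact ⟨h1.mono hT subset_rfl, h.anti_right _ h2 _ (image_mono (sdiff_subset_sdiff_left hT)),
      h3.subset (inter_subset_inter_left _ hT)⟩
  · intro S hS
    have hpS : AsympDisjoint (p '' (S \ G)) C := by
      refine asympDisjoint_iff.2 fun R => isBounded_image_subtype_val.1 ?_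
      refine ((hnear hS R).cthickening (δ := R)).subset ?_
      rintro _ ⟨_, ⟨⟨x, ⟨hxS, hxG⟩, rfl⟩, z, hz, hyz⟩, rfl⟩
      have h2 : dist x (p x) ≤ c (p x) := not_lt.1 fun hx => hxG (Or.inl (Or.inl hx))
      have h3 : c (p x) ≤ R := (infDist_le_dist_of_mem (mem_insert_of_mem y₀ hz)).trans hyz
      refine mem_cthickening_of_dist_le _ x _ _ ⟨hxS, h2.trans h3, h3⟩ ?_
      rw [dist_comm]
      exact h2.trans h3
    obtain ⟨T₁, h₁, T₂, h₂, hT⟩ := h.cover _ hpS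
    have hEG : EA ⊆ G := fun z hz => Or.inl (Or.inr hz)
    have key : ∀ x ∈ S, x ∉ G → p x ∈ T₁ ∨ p x ∈ T₂ := fun x hx hxG => by
      rw [← mem_union, ← hT]; exact mem_image_of_mem p ⟨hx, hxG⟩
    refine ⟨{x ∈ S | x ∉ G ∧ p x ∈ T₁ ∨ x ∈ EA}, ⟨hS.mono (sep_subset _ _) subset_rfl,
      h.anti_left _ h₁ _ ?_, ?_⟩, {x ∈ S | x ∉ G ∧ p x ∈ T₂ ∨ x ∈ G \ EA},
      ⟨hS.mono (sep_subset _ _) subset_rfl, h.anti_right _ h₂ _ ?_, ?_⟩, ?_⟩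
    · rintro _ ⟨x, ⟨⟨-, hx | hx⟩, hxG⟩, rfl⟩
      · exact hx.2
      · exact absurd (hEG hx) hxG
    · convert isBounded_empty
      refine eq_empty_of_forall_notMem ?_
      rintro x ⟨⟨-, hx | hx⟩, hxG, hxE⟩
      · exact hx.1 hxG
      · exact hxE hx
    · rintro _ ⟨x, ⟨⟨-, hx | hx⟩, hxG⟩, rfl⟩
      · exact hx.2
      · exact absurd hx.1 hxG
    · convert isBounded_empty
      refine eq_empty_of_forall_notMem ?_
      rintro x ⟨⟨-, hx | hx⟩, hxE⟩
      · exact hx.1 (hEG hxE)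
      · exact hx.2 hxE
    · ext x
      constructor
      · intro hx
        by_cases hxE : x ∈ EA
        · exact Or.inl ⟨hx, Or.inr hxE⟩
        by_cases hxG : x ∈ G
        · exact Or.inr ⟨hx, Or.inr ⟨hxG, hxE⟩⟩
        rcases key x hx hxG with h' | h'
        · exact Or.inl ⟨hx, Or.inl ⟨hxG, h'⟩⟩
        · exact Or.inr ⟨hx, Or.inl ⟨hxG, h'⟩⟩
      · rintro (hx | hx) <;> exact hx.1
  · refine h.anti_left _ h.mem_left _ ?_
    rintro _ ⟨x, ⟨hxA, hxG⟩, rfl⟩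
    by_contra hx
    exact hxG (Or.inl (Or.inr ⟨hxA, Or.inr hx⟩))
  -- Points of `A` in `F` already belong to `EA`, so only points of `EB`, hence of `B`, remain.
  · refine hAB.isBounded_inter.subset ?_
    rintro x ⟨hxA, (hx | hx) | hx, hxE⟩
    · exact absurd ⟨hxA, Or.inl hx⟩ hxE
    · exact absurd hx hxE
    · exact ⟨hxA, hx.1⟩
  · refine h.anti_right _ h.mem_right _ ?_
    rintro _ ⟨x, ⟨hxB, hxG⟩, rfl⟩
    by_contra hx
    exact hxG (Or.inr ⟨hxB, Or.inr hx⟩)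
  · exact hAB.isBounded_inter.subset fun x hx => ⟨hx.2.1, hx.1⟩

/-! ### Kernels and the main theorem -/

theorem IsKernel.exists_forall_eq {X : Type u} [MetricSpace X] {X₀ : Set X} (h : IsKernel X₀)
    (R : ℝ) : ∃ D : ℝ, ∀ x y : X, D < infDist x X₀ → dist x y ≤ R → x = y := by
  obtain ⟨-, k, hk, hball⟩ := h
  obtain ⟨m, hm⟩ := exists_nat_gt R
  obtain ⟨i, hi⟩ := (hk.eventually_ge_atTop m).exists
  refine ⟨i, fun x y hx hxy => ?_⟩
  have hx' : x ∉ cthickening (i : ℝ) X₀ := fun hmem =>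
    hx.not_ge (ENNReal.toReal_le_of_le_ofReal i.cast_nonneg hmem)
  have hy : y ∈ ball x (k i : ℝ) := by
    rw [mem_ball']
    have : (m : ℝ) ≤ k i := by exact_mod_cast hi
    linarith
  rw [hball i x hx'] at hy
  exact hy.symm

theorem theorem1 {X : Type u} [MetricSpace X] [ProperSpace X] (X₀ : Set X)
    (hclosed : IsClosed X₀) (hker : IsKernel X₀) (k : ℕ) (hX₀ : AsIndLE X₀ k) :
    AsIndLE X k := by
  have hne : X₀.Nonempty := by
    rw [nonempty_iff_ne_empty]
    rintro rfl
    exact hker.1 isBounded_empty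
  have : ProperSpace X₀ := ProperSpace.of_isClosed hclosed
  intro A B hAB
  obtain ⟨x₀, hx₀⟩ := hne
  -- The distances to `A` and `B` are meaningful only for nonempty sets. The added point is dropped
  -- at the end, since the sides of a separation are closed under subsets.
  have hAB' : AsympDisjoint (insert x₀ A) (insert x₀ B) :=
    (hAB.insert_left x₀).insert_right x₀
  have hA := insert_nonempty x₀ A
  have hB := insert_nonempty x₀ B
  choose q hq hqd using hclosed.exists_infDist_eq_dist ⟨x₀, hx₀⟩
  obtain ⟨C, hC, hCk⟩ := hX₀ _ _ (asympDisjoint_closerPart hAB' hA hB)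
  obtain ⟨𝓤, 𝓥, hs⟩ := hC.exists_asympSeparation
  obtain ⟨𝓤', 𝓥', hs'⟩ := hs.extend (p := fun x => ⟨q x, hq x⟩)
    (fun x y => hqd x ▸ infDist_le_dist_of_mem y.2)
    (fun R => by simpa only [hqd] using hker.exists_forall_eq R) hAB' hA hB ⟨x₀, hx₀⟩
  have hs'' : AsympSeparation A B (Subtype.val '' C) 𝓤' 𝓥' :=
    { hs' with
      mem_left := hs'.anti_left _ hs'.mem_left _ (subset_insert _ _)
      mem_right := hs'.anti_right _ hs'.mem_right _ (subset_insert _ _) }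
  have : ProperSpace C := ProperSpace.of_isClosed hC.1
  exact ⟨Subtype.val '' C,
    hs''.isAsympSeparator (hclosed.isClosedEmbedding_subtypeVal.isClosedMap _ hC.1),
    hCk.congr (isometry_subtype_coe.isometryEquivImage C)⟩
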